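/- Let $m\ge 0$ be an integer, let $\alpha,\alpha_1,\dots,\alpha_m$ be real numbers with $0<\alpha<1$ and $0<\alpha_i<\alpha$ for $i=1,\dots,m$, let $b_1,\dots,b_m>0$, and let $\lambda>0$. For $\beta_1,\dots,\beta_n,\beta>0$ let $$E_{(\beta_1,\dots,\beta_n),\beta}(z_1,\dots,z_n)=\sum_{k=0}^\infty\ \sum_{\substack{l_1+\dots+l_n=k\\ l_1,\dots,l_n\ge 0}}\frac{k!}{l_1!\cdots l_n!}\,\frac{\prod_{i=1}^n z_i^{l_i}}{\Gamma\left(\beta+\sum_{i=1}^n\beta_i l_i\right)}$$ be the multinomial Mittag-Leffler function, put $\vec\alpha=(\alpha,\alpha-\alpha_1,\dots,\alpha-\alpha_m)$, and for $t>0$ define $$\bar E(t)=t^{\alpha-1}E_{\vec\alpha,\alpha}\left(-\lambda t^{\alpha},-b_1t^{\alpha-\alpha_1},\dots,-b_mt^{\alpha-\alpha_m}\right).$$ Then the series defining $\bar E(t)$ converges for every $t>0$, and $\bar E$ is completely monotone on $(0,\infty)$, i.e. $\bar E\in C^\infty(0,\infty)$ and $(-1)^n\bar E^{(n)}(t)\ge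 0$ for all integers $n\ge 0$ and all $t>0$. Moreover, for every $T>0$, $\bar E$ is integrable on $(0,T)$ and $$\int_0^T|\bar E(t)|\,dt<\frac1{\lambda}.$$ In particular this holds with $\lambda=\lambda_j$ for each eigenvalue $\lambda_j>0$, $j\in\mathbb N$, of the Dirichlet Laplacian $-\Delta$ on a bounded domain. -/

import Mathlib

open scoped ContDiff

noncomputable section

/-- The part of total degree `k` of the multinomial Mittag-Leffler series,
`∑_{l_1 + ... + l_n = k} (k; l_1, ..., l_n) ∏ z_i ^ l_i / Γ(β₀ + ∑ β_i l_i)`. -/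
def multinomialMLTerm {𝕜 : Type*} [RCLike 𝕜] {n : ℕ} (β : Fin n → ℝ) (β₀ : ℝ) (z : Fin n → 𝕜)
    (k : ℕ) : 𝕜 :=
  ∑ l ∈ Finset.piAntidiag (Finset.univ : Finset (Fin n)) k,
    (Nat.multinomial Finset.univ l : 𝕜) *
      ((∏ i, z i ^ l i) / ((Real.Gamma (β₀ + ∑ i, β i * (l i : ℝ)) : ℝ) : 𝕜))

/-- The multinomial Mittag-Leffler function `E_{(β_1, ..., β_n), β₀}(z_1, ..., z_n)`, for real
or complex arguments. -/
def multinomialML {𝕜 : Type*} [RCLike 𝕜] {n : ℕ} (β : Fin n → ℝ) (β₀ : ℝ) (z : Fin n → 𝕜) : 𝕜 :=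
  ∑' k : ℕ, multinomialMLTerm β β₀ z k

/-- The exponents `(α, α - α_1, ..., α - α_m)`. -/
def kernelOrders {m : ℕ} (α : ℝ) (a : Fin m → ℝ) : Fin (m + 1) → ℝ :=
  Matrix.vecCons α fun i => α - a i

/-- The arguments `(-λ t^α, -b_1 t^(α - α_1), ..., -b_m t^(α - α_m))`. -/
def kernelArgs {m : ℕ} (α : ℝ) (a b : Fin m → ℝ) (lam t : ℝ) : Fin (m + 1) → ℝ :=
  Matrix.vecCons (-lam * t ^ α) fun i => -b i * t ^ (α - a i)

/-- The scalar kernel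
`t^(α-1) E_{(α, α-α_1, ..., α-α_m), α}(-λ t^α, -b_1 t^(α-α_1), ..., -b_m t^(α-α_m))`. -/
def scalarKernel {m : ℕ} (α : ℝ) (a b : Fin m → ℝ) (lam t : ℝ) : ℝ :=
  t ^ (α - 1) * multinomialML (kernelOrders α a) α (kernelArgs α a b lam t)

/-- Complete monotonicity on `(0, ∞)`: `f` is smooth there and `(-1)^n f^(n) ≥ 0` for all `n`. -/
def IsCompletelyMonotone (f : ℝ → ℝ) : Prop :=
  ContDiffOn ℝ ∞ f (Set.Ioi 0) ∧
    ∀ (n : ℕ) (t : ℝ), 0 < t → 0 ≤ (-1) ^ n * iteratedDerivWithin n f (Set.Ioi 0) t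

end

/-! For large `s`, termwise integration of the series shows that the kernel has Laplace transform `1
/ P(s)` with `P(s) = s^α + λ + ∑ b_i s^(α_i)` (`exists_laplace_scalarKernel`).

Since all exponents lie in `(0, 1)`, `Im P > 0` above the slit `(-∞, 0]` and on its upper side
(`logSymbol_im_pos`). So `1 / P` is holomorphic on the slit plane, and Cauchy's theorem writes it as
a Stieltjes integral `∫ ρ(r) / (r + s) dr` with `ρ > 0` (`stieltjes_of_im_nonpos`). The coordinate
`w = log s` turns the slit plane into the strip `|Im w| ≤ π`, where the two sides of the slit are
distinct edges and contours are rectangles.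

As `1 / (r + s)` is the Laplace transform of `exp (-r t)`, the function `1 / P` is also the
transform of `∫ exp (-r t) ρ(r) dr`. Injectivity (`ae_eq_zero_of_laplace_eq_zero`) and continuity
identify this with the kernel. Written as the moment generating function of `-exp x` under a
positive measure, it is completely monotone (`isCompletelyMonotone_mgf`). Its transform is now known
for every `s > 0` and is at most `1 / λ`; letting `s → 0` bounds the integrals, and positivity of
the kernel beyond `T` makes the bound strict (`integral_lt_of_laplace_le`). -/

open MeasureTheory ProbabilityTheory Filter Topology Set

/-! ### Laplace transforms of measures on the negative half-line -/

section LaplaceTransform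

variable {Ω : Type*} [MeasurableSpace Ω] {X : Ω → ℝ} {μ : Measure Ω}

/-- With `y = -X > 0`, the bounds `1 + t y ≤ exp (t y)` and `1 + y ≤ (1 + 1/t) (1 + t y)` give `exp
(-t y) ≤ (1 + 1/t) / (1 + y)`. One integrable resolvent thus controls every exponential; `μ` need
not be finite. -/
theorem integrable_exp_mul_of_integrable_inv_sub (hX : Measurable X) (hneg : ∀ x, X x < 0)
    (hint : Integrable (fun x => (1 - X x)⁻¹) μ) {t : ℝ} (ht : 0 < t) :
    Integrable (fun x => Real.exp (t * X x)) μ := by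
  refine (hint.const_mul (1 + 1 / t)).mono' (by fun_prop) (ae_of_all _ fun x => ?_)
  have hy := hneg x
  have h1 : 0 < 1 - X x := by linarith
  rw [Real.norm_of_nonneg (Real.exp_pos _).le, ← div_eq_mul_inv, le_div_iff₀ h1]
  have h2 : 1 + t * (-X x) ≤ Real.exp (t * (-X x)) := by
    linarith [Real.add_one_le_exp (t * (-X x))]
  have h3 : Real.exp (t * X x) * Real.exp (t * (-X x)) = 1 := by
    rw [← Real.exp_add]; simp
  have h4 : 1 - X x ≤ (1 + 1 / t) * (1 + t * (-X x)) := by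
    have : (1 + 1 / t) * (1 + t * (-X x)) = 1 - X x + t * (-X x) + 1 / t := by
      field_simp; ring
    rw [this]
    have : 0 < t * (-X x) := mul_pos ht (by linarith)
    have : 0 < 1 / t := by positivity
    linarith
  calc Real.exp (t * X x) * (1 - X x)
      ≤ Real.exp (t * X x) * ((1 + 1 / t) * Real.exp (t * (-X x))) := by
        gcongr
        exact h4.trans (by gcongr)
    _ = (1 + 1 / t) * (Real.exp (t * X x) * Real.exp (t * (-X x))) := by ring
    _ = 1 + 1 / t := by rw [h3, mul_one]

theorem Ioi_subset_interior_integrableExpSet (hX : Measurable X) (hneg : ∀ x, X x < 0)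
    (hint : Integrable (fun x => (1 - X x)⁻¹) μ) :
    Ioi (0 : ℝ) ⊆ interior (integrableExpSet X μ) :=
  interior_maximal (fun _ ht => integrable_exp_mul_of_integrable_inv_sub hX hneg hint ht) isOpen_Ioi

/-- The `n`-th derivative is `∫ X^n exp (t X)`, and `X < 0` gives it the sign `(-1)^n`. -/
theorem isCompletelyMonotone_mgf (hX : Measurable X) (hneg : ∀ x, X x < 0)
    (hint : Integrable (fun x => (1 - X x)⁻¹) μ) : IsCompletelyMonotone (mgf X μ) := by
  have hsub := Ioi_subset_interior_integrableExpSet hX hneg hint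
  refine ⟨(analyticOnNhd_mgf.mono hsub).contDiffOn (uniqueDiffOn_Ioi 0), fun n t ht => ?_⟩
  rw [iteratedDerivWithin_of_isOpen isOpen_Ioi ht, iteratedDeriv_mgf (hsub ht),
    ← integral_const_mul]
  refine integral_nonneg fun x => ?_
  have : (0 : ℝ) ≤ (-X x) ^ n := pow_nonneg (by linarith [hneg x]) n
  rw [neg_pow] at this
  simp only [Pi.zero_apply, ← mul_assoc]
  positivity

theorem integrable_prod_exp_neg_mul_exp [SFinite μ] (hX : Measurable X) (hneg : ∀ x, X x < 0)
    {s : ℝ} (hs : 0 < s) (hint : Integrable (fun x => (s - X x)⁻¹) μ) :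
    Integrable (fun p : ℝ × Ω => Real.exp (-(s * p.1)) * Real.exp (p.1 * X p.2))
      ((volume.restrict (Ioi 0)).prod μ) := by
  have hexp (t : ℝ) (x : Ω) : Real.exp (-(s * t)) * Real.exp (t * X x) =
      Real.exp (-(s - X x) * t) := by
    rw [← Real.exp_add]; ring_nf
  rw [integrable_prod_iff' (by fun_prop)]
  refine ⟨ae_of_all _ fun x => ?_, ?_⟩
  · simp only [hexp]
    exact integrableOn_exp_mul_Ioi (by linarith [hneg x]) 0
  · refine hint.congr (ae_of_all _ fun x => ?_)
    simp only [hexp, Real.norm_of_nonneg (Real.exp_pos _).le]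
    rw [integral_exp_mul_Ioi (by linarith [hneg x])]
    rw [mul_zero, Real.exp_zero, neg_div_neg_eq, one_div]

theorem integrableOn_exp_neg_mul_mgf [SFinite μ] (hX : Measurable X) (hneg : ∀ x, X x < 0)
    {s : ℝ} (hs : 0 < s) (hint : Integrable (fun x => (s - X x)⁻¹) μ) :
    IntegrableOn (fun t => Real.exp (-(s * t)) * mgf X μ t) (Ioi 0) := by
  have := (integrable_prod_exp_neg_mul_exp hX hneg hs hint).integral_prod_left
  simpa only [integral_const_mul, mgf, IntegrableOn] using this

theorem integral_exp_neg_mul_mgf [SFinite μ] (hX : Measurable X) (hneg : ∀ x, X x < 0)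
    {s : ℝ} (hs : 0 < s) (hint : Integrable (fun x => (s - X x)⁻¹) μ) :
    ∫ t in Ioi (0 : ℝ), Real.exp (-(s * t)) * mgf X μ t = ∫ x, (s - X x)⁻¹ ∂μ := by
  have hexp (t : ℝ) (x : Ω) : Real.exp (-(s * t)) * Real.exp (t * X x) =
      Real.exp (-(s - X x) * t) := by
    rw [← Real.exp_add]; ring_nf
  simp only [mgf, ← integral_const_mul]
  rw [integral_integral_swap (integrable_prod_exp_neg_mul_exp hX hneg hs hint)]
  refine integral_congr_ae (ae_of_all _ fun x => ?_)
  simp only [hexp]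
  rw [integral_exp_mul_Ioi (by linarith [hneg x])]
  rw [mul_zero, Real.exp_zero, neg_div_neg_eq, one_div]

end LaplaceTransform

/-! ### Uniqueness for the Laplace transform -/

/-- Two finite measures on the line whose moment generating functions are finite and agree near
`0` are equal. -/
theorem ext_of_eventuallyEq_mgf {μ ν : Measure ℝ} [IsFiniteMeasure μ] [IsFiniteMeasure ν]
    {ε : ℝ} (hε : 0 < ε)
    (hμ : ∀ u ∈ Ioo (-ε) ε, Integrable (fun x => Real.exp (u * x)) μ)
    (hν : ∀ u ∈ Ioo (-ε) ε, Integrable (fun x => Real.exp (u * x)) ν)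
    (h : ∀ u ∈ Ioo (-ε) ε, mgf id μ u = mgf id ν u) : μ = ν := by
  have hμ' : Ioo (-ε) ε ⊆ interior (integrableExpSet id μ) := interior_maximal hμ isOpen_Ioo
  have hν' : Ioo (-ε) ε ⊆ interior (integrableExpSet id ν) := interior_maximal hν isOpen_Ioo
  have h0 : (0 : ℝ) ∈ Ioo (-ε) ε := ⟨by linarith, hε⟩
  -- Both complex moment generating functions are analytic on a vertical strip and agree on its real
  -- segment, hence on the whole strip. Its imaginary axis carries the characteristic functions.
  have heq : EqOn (complexMGF id μ) (complexMGF id ν) {z | z.re ∈ Ioo (-ε) ε} := by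
    refine AnalyticOnNhd.eqOn_of_preconnected_of_frequently_eq
      (analyticOnNhd_complexMGF.mono fun z hz => hμ' hz)
      (analyticOnNhd_complexMGF.mono fun z hz => hν' hz)
      ((convex_Ioo (-ε) ε).linear_preimage Complex.reLm).isPreconnected
      (z₀ := ((0 : ℝ) : ℂ)) (by simpa using hε) ?_
    have h_real : ∃ᶠ (x : ℝ) in 𝓝[≠] 0, complexMGF id μ x = complexMGF id ν x := by
      refine Eventually.frequently ?_
      filter_upwards [nhdsWithin_le_nhds (isOpen_Ioo.mem_nhds h0)] with x hx
      rw [complexMGF_ofReal, complexMGF_ofReal, h x hx]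
    rw [frequently_iff_seq_forall] at h_real ⊢
    obtain ⟨xs, hx_tendsto, hx_eq⟩ := h_real
    refine ⟨fun n => xs n, ?_, fun n => by simp [hx_eq]⟩
    rw [tendsto_nhdsWithin_iff] at hx_tendsto ⊢
    exact ⟨(Complex.continuous_ofReal.tendsto _).comp hx_tendsto.1, by simpa using hx_tendsto.2⟩
  refine Measure.ext_of_charFun (funext fun t => ?_)
  rw [← complexMGF_id_mul_I, ← complexMGF_id_mul_I]
  exact heq (by simpa using hε)

/-- Injectivity of the Laplace transform. -/
theorem ae_eq_zero_of_laplace_eq_zero {f : ℝ → ℝ} {s₀ : ℝ}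
    (hf : ∀ s, s₀ ≤ s → IntegrableOn (fun t => Real.exp (-(s * t)) * f t) (Ioi 0))
    (h0 : ∀ s, s₀ ≤ s → ∫ t in Ioi (0 : ℝ), Real.exp (-(s * t)) * f t = 0) :
    f =ᵐ[volume.restrict (Ioi 0)] 0 := by
  -- The damping is centred at `s₀ + 1` so that every `u` in `(-1, 1)` corresponds to a parameter
  -- `s₀ + 1 - u > s₀`.
  set g : ℝ → ℝ := fun t => Real.exp (-((s₀ + 1) * t)) * f t with hg
  have hgi : IntegrableOn g (Ioi 0) := hf _ (by linarith)
  have hmul (u t : ℝ) : Real.exp (u * t) * g t = Real.exp (-((s₀ + 1 - u) * t)) * f t := by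
    rw [hg, ← mul_assoc, ← Real.exp_add]; ring_nf
  have hui (u : ℝ) (hu : u ∈ Ioo (-1 : ℝ) 1) : IntegrableOn (fun t => Real.exp (u * t) * g t)
      (Ioi 0) := by
    simp only [hmul]; exact hf _ (by linarith [hu.2])
  -- `ENNReal.ofReal` truncates negative values to `0`, so `μ` and `ν` have the positive and
  -- negative parts of `g` as densities; `g = 0` a.e. will follow from `μ = ν`.
  set μ := (volume.restrict (Ioi (0 : ℝ))).withDensity fun t => ENNReal.ofReal (g t) with hμ
  set ν := (volume.restrict (Ioi (0 : ℝ))).withDensity fun t => ENNReal.ofReal (-g t) with hν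
  have hfμ : IsFiniteMeasure μ := isFiniteMeasure_withDensity_ofReal hgi.2
  have hfν : IsFiniteMeasure ν := isFiniteMeasure_withDensity_ofReal hgi.neg.2
  have key (u : ℝ) (k : ℝ → ℝ) (hk : AEMeasurable k (volume.restrict (Ioi (0 : ℝ))))
      (hki : IntegrableOn (fun t => Real.exp (u * t) * k t) (Ioi 0)) :
      Integrable (fun x => Real.exp (u * x))
        ((volume.restrict (Ioi (0 : ℝ))).withDensity fun t => ENNReal.ofReal (k t)) ∧
      mgf id ((volume.restrict (Ioi (0 : ℝ))).withDensity fun t => ENNReal.ofReal (k t)) u =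
        ∫ t in Ioi (0 : ℝ), max (Real.exp (u * t) * k t) 0 := by
    have hmax (t : ℝ) : (ENNReal.ofReal (k t)).toReal • Real.exp (u * t) =
        max (Real.exp (u * t) * k t) 0 := by
      rw [ENNReal.toReal_ofReal', smul_eq_mul, mul_comm, mul_max_of_nonneg _ _ (Real.exp_pos _).le,
        mul_zero]
    constructor
    · rw [integrable_withDensity_iff_integrable_smul₀' hk.ennreal_ofReal (by simp)]
      simp only [hmax]
      exact hki.pos_part
    · rw [mgf, integral_withDensity_eq_integral_toReal_smul₀ hk.ennreal_ofReal (by simp)]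
      simp only [id, hmax]
  have hgm : AEMeasurable g (volume.restrict (Ioi (0 : ℝ))) := hgi.1.aemeasurable
  have hμν : μ = ν := by
    have hui' (u : ℝ) (hu : u ∈ Ioo (-1 : ℝ) 1) :
        IntegrableOn (fun t => Real.exp (u * t) * -g t) (Ioi 0) :=
      (hui u hu).neg.congr_fun (fun t _ => by simp) measurableSet_Ioi
    refine ext_of_eventuallyEq_mgf one_pos (fun u hu => (key u g hgm (hui u hu)).1)
      (fun u hu => (key u (fun t => -g t) hgm.neg (hui' u hu)).1) fun u hu => ?_
    · rw [(key u g hgm (hui u hu)).2, (key u (fun t => -g t) hgm.neg (hui' u hu)).2,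
        ← sub_eq_zero, ← integral_sub (hui u hu).pos_part (hui' u hu).pos_part]
      refine Eq.trans ?_ (h0 (s₀ + 1 - u) (by linarith [hu.2]))
      refine integral_congr_ae (ae_of_all _ fun t => ?_)
      simp only [← hmul, mul_neg]
      rcases le_total 0 (Real.exp (u * t) * g t) with h | h
      · rw [max_eq_left h, max_eq_right (by linarith)]; ring
      · rw [max_eq_right h, max_eq_left (by linarith)]; ring
  rw [hμ, hν, withDensity_eq_iff hgm.ennreal_ofReal (f := fun t => ENNReal.ofReal (g t))
    (g := fun t => ENNReal.ofReal (-g t)) hgm.neg.ennreal_ofReal] at hμν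
  · filter_upwards [hμν] with t ht
    have : g t = 0 := by
      rcases le_total 0 (g t) with h | h
      · rw [ENNReal.ofReal_of_nonpos (p := -g t) (by linarith), ENNReal.ofReal_eq_zero] at ht
        linarith
      · rw [ENNReal.ofReal_of_nonpos h, eq_comm, ENNReal.ofReal_eq_zero] at ht
        linarith
    simpa [hg, (Real.exp_pos _).ne'] using this
  · have := hfμ.measure_univ_lt_top
    rw [withDensity_apply _ MeasurableSet.univ, Measure.restrict_univ] at this
    exact this.ne

/-! ### Stieltjes representation by a contour integral in the strip -/

section Stieltjes

open Complex

/-- The closed strip `|Im w| ≤ π`, the image under the logarithm of the slit plane with both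
sides of the slit. -/
def logStrip : Set ℂ := {w | |w.im| ≤ Real.pi}

theorem add_mul_I_mem_logStrip {x y : ℝ} (hy : |y| ≤ Real.pi) : (x + y * I : ℂ) ∈ logStrip := by
  simpa [logStrip] using hy

theorem logStrip_mem_nhds_ofReal (x : ℝ) : logStrip ∈ 𝓝 (x : ℂ) := by
  have : {w : ℂ | |w.im| < Real.pi} ∈ 𝓝 (x : ℂ) :=
    (isOpen_lt (by fun_prop) (by fun_prop)).mem_nhds (by simpa using Real.pi_pos)
  exact mem_of_superset this fun w hw => (show |w.im| < Real.pi from hw).le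

theorem eq_of_exp_eq_of_mem_logStrip {w : ℂ} {u : ℝ} (hw : w ∈ logStrip)
    (h : exp w = exp u) : w = u := by
  obtain ⟨n, hn⟩ := exp_eq_exp_iff_exists_int.1 h
  have him := congrArg im hn
  have hw' : |w.im| ≤ Real.pi := hw
  simp at him
  have hn0 : n = 0 := by
    rw [him, abs_mul, abs_of_pos (by positivity : 0 < 2 * Real.pi)] at hw'
    by_contra hne
    have : (1 : ℝ) ≤ |(n : ℝ)| := by exact_mod_cast Int.one_le_abs hne
    nlinarith [Real.pi_pos]
  simpa [hn0] using hn

/-- The difference quotient of `h` with respect to `exp`, times `exp`. -/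
noncomputable def expSlope (h : ℂ → ℂ) (u w : ℂ) : ℂ :=
  dslope h u w / dslope exp u w * exp w

theorem expSlope_of_ne {h : ℂ → ℂ} {u w : ℂ} (hne : w ≠ u) :
    expSlope h u w = (h w - h u) / (exp w - exp u) * exp w := by
  have : w - u ≠ 0 := sub_ne_zero.2 hne
  rw [expSlope, dslope_of_ne _ hne, dslope_of_ne _ hne, slope_def_field, slope_def_field,
    div_div_div_cancel_right₀ this]

/-- Subtracting `h u` makes the singularity at `u` removable, so Cauchy's theorem applies without
residues. The denominator vanishes nowhere else, because `exp` takes the value `exp u` only at `u`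
within the strip, and at `u` its slope is `exp u ≠ 0`. -/
theorem differentiableOn_expSlope {h : ℂ → ℂ} (hh : DifferentiableOn ℂ h logStrip) (u : ℝ) :
    DifferentiableOn ℂ (expSlope h u) logStrip := by
  have hu := logStrip_mem_nhds_ofReal u
  refine (((differentiableOn_dslope hu).2 hh).div
    ((differentiableOn_dslope hu).2 differentiable_exp.differentiableOn) fun w hw => ?_).mul
    differentiable_exp.differentiableOn
  by_cases hne : w = u
  · rw [hne, dslope_same, Complex.deriv_exp]; exact exp_ne_zero _
  · rw [dslope_of_ne _ hne, slope_def_field]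
    exact div_ne_zero (sub_ne_zero.2 fun h => hne (eq_of_exp_eq_of_mem_logStrip hw h))
      (sub_ne_zero.2 hne)

theorem expSlope_boundary_integral {h : ℂ → ℂ} (hh : DifferentiableOn ℂ h logStrip) (u N : ℝ) :
    (∫ x in (-N)..N, (expSlope h u (x + (-Real.pi : ℝ) * I) - expSlope h u (x + Real.pi * I))) +
      I * (∫ y in (-Real.pi)..Real.pi, expSlope h u (N + y * I)) -
      I * (∫ y in (-Real.pi)..Real.pi, expSlope h u ((-N : ℝ) + y * I)) = 0 := by
  have hd := differentiableOn_expSlope hh u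
  have hpi := Real.pi_pos
  have key := integral_boundary_rect_eq_zero_of_differentiableOn (expSlope h u)
    (-N - Real.pi * I) (N + Real.pi * I) (hd.mono fun w hw => ?_)
  · have hcont (y : ℝ) (hy : |y| ≤ Real.pi) :
        Continuous fun x : ℝ => expSlope h u (x + y * I) :=
      hd.continuousOn.comp_continuous (by fun_prop) fun x => add_mul_I_mem_logStrip hy
    rw [intervalIntegral.integral_sub
      ((hcont _ (by rw [abs_neg, abs_of_pos hpi])).intervalIntegrable _ _)
      ((hcont _ (by rw [abs_of_pos hpi])).intervalIntegrable _ _)]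
    simpa using key
  · have := (mem_reProdIm.1 hw).2
    simp only [sub_im, neg_im, ofReal_im, mul_im, ofReal_re, I_im, mul_one, I_re, mul_zero,
      add_zero, neg_zero, zero_sub, add_im, zero_add] at this
    rw [uIcc_of_le (by linarith)] at this
    exact abs_le.2 this

/-- Both edges have `exp w = -exp x`, so the `h u` terms cancel and conjugate symmetry leaves only
the imaginary part of `h`. -/
theorem expSlope_bottom_sub_top {h : ℂ → ℂ}
    (hconj : ∀ x : ℝ, h (x + (-Real.pi : ℝ) * I) = (starRingEnd ℂ) (h (x + Real.pi * I)))
    (u x : ℝ) :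
    expSlope h u (x + (-Real.pi : ℝ) * I) - expSlope h u (x + Real.pi * I) =
      I * ((2 * (-(h (x + Real.pi * I)).im) * (Real.exp x / (Real.exp x + Real.exp u)) : ℝ) : ℂ) := by
  have hpi := Real.pi_pos.ne'
  have h1 : exp (x + Real.pi * I) = -exp x := by rw [exp_add, exp_pi_mul_I]; ring
  have h2 : exp (x + (-Real.pi : ℝ) * I) = -exp x := by
    rw [exp_add, ofReal_neg, neg_mul, exp_neg (Real.pi * I), exp_pi_mul_I]; norm_num
  have hne : (exp x + exp u : ℂ) ≠ 0 := by
    rw [← ofReal_exp, ← ofReal_exp, ← ofReal_add, ofReal_ne_zero]; positivity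
  rw [expSlope_of_ne, expSlope_of_ne, h1, h2, hconj]
  · have h3 : (starRingEnd ℂ) (h (x + Real.pi * I)) =
        h (x + Real.pi * I) - 2 * (h (x + Real.pi * I)).im * I := by
      apply Complex.ext <;> simp; ring
    have hne' : (-exp x - exp u : ℂ) ≠ 0 := by
      rw [← neg_add']; exact neg_ne_zero.2 hne
    rw [h3]
    push_cast
    field_simp
    ring
  · intro h
    simpa [hpi] using congrArg im h
  · intro h
    simpa [hpi] using congrArg im h

theorem tendsto_edge_integral {F : ℝ → ℝ → ℂ} {L : ℂ}
    (hF : ∀ N, ContinuousOn (F N) (Icc (-Real.pi) Real.pi))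
    (h : ∀ ε > 0, ∀ᶠ N : ℝ in atTop, ∀ y : ℝ, |y| ≤ Real.pi → ‖F N y - L‖ ≤ ε) :
    Tendsto (fun N : ℝ => ∫ y in (-Real.pi)..Real.pi, F N y) atTop (𝓝 (2 * Real.pi * L)) := by
  have hpi := Real.pi_pos
  rw [Metric.tendsto_nhds]
  intro ε hε
  -- The edge has length `2π`, so this choice gives an error of at most `ε / 2`.
  filter_upwards [h (ε / (4 * Real.pi)) (by positivity)] with N hN
  have hint : IntervalIntegrable (F N) volume (-Real.pi) Real.pi :=
    ContinuousOn.intervalIntegrable (by rw [uIcc_of_le (by linarith)]; exact hF N)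
  have hL : (2 * Real.pi * L : ℂ) = ∫ _ in (-Real.pi)..Real.pi, L := by
    rw [intervalIntegral.integral_const, real_smul]; push_cast; ring
  rw [dist_eq_norm, hL, ← intervalIntegral.integral_sub hint (by simp)]
  refine (intervalIntegral.norm_integral_le_of_norm_le_const
    (C := ε / (4 * Real.pi)) fun y hy => hN y ?_).trans_lt ?_
  · rw [uIoc_of_le (by linarith)] at hy
    exact abs_le.2 ⟨hy.1.le, hy.2⟩
  · rw [sub_neg_eq_add, abs_of_pos (by linarith)]
    have : ε / (4 * Real.pi) * (Real.pi + Real.pi) = ε / 2 := by field_simp; ring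
    linarith

theorem continuousOn_expSlope_edge {h : ℂ → ℂ} (hh : DifferentiableOn ℂ h logStrip) (u N : ℝ) :
    ContinuousOn (fun y : ℝ => expSlope h u (N + y * I)) (Icc (-Real.pi) Real.pi) :=
  (differentiableOn_expSlope hh u).continuousOn.comp (by fun_prop)
    fun _ hy => add_mul_I_mem_logStrip (abs_le.2 hy)

theorem norm_exp_add_mul_I (x y : ℝ) : ‖exp (x + y * I)‖ = Real.exp x := by
  simp [norm_exp]

/-- Far to the right `h w → 0` and `exp w / (exp w - exp u) → 1`, so the integrand tends uniformly
to `-h u`. This edge produces the represented value. -/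
theorem tendsto_right_edge {h : ℂ → ℂ} (hh : DifferentiableOn ℂ h logStrip) (u : ℝ)
    (hdecay : ∀ ε > 0, ∀ᶠ x : ℝ in atTop, ∀ y : ℝ, |y| ≤ Real.pi → ‖h (x + y * I)‖ ≤ ε) :
    Tendsto (fun N : ℝ => ∫ y in (-Real.pi)..Real.pi, expSlope h u (N + y * I)) atTop
      (𝓝 (2 * Real.pi * -h u)) := by
  refine tendsto_edge_integral (continuousOn_expSlope_edge hh u) fun ε hε => ?_
  filter_upwards [hdecay (ε / 4) (by positivity), eventually_gt_atTop u,
    Real.tendsto_exp_atTop.eventually_ge_atTop (2 * Real.exp u),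
    Real.tendsto_exp_atTop.eventually_ge_atTop (4 * (‖h u‖ * Real.exp u) / ε)]
    with N h1 h2 h3 h4 y hy
  have hw := norm_exp_add_mul_I N y
  have hu : ‖exp (u : ℂ)‖ = Real.exp u := by simp [norm_exp]
  have hN := Real.exp_pos N
  have hden : Real.exp N / 2 ≤ ‖exp (N + y * I) - exp u‖ := by
    have := norm_sub_norm_le (exp (N + y * I)) (exp u)
    rw [hw, hu] at this
    linarith
  have hden0 : exp (N + y * I) - exp u ≠ 0 := norm_pos_iff.1 (by linarith)
  rw [expSlope_of_ne]
  · have : (h (N + y * I) - h u) / (exp (N + y * I) - exp u) * exp (N + y * I) - -h u =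
        (h (N + y * I) * exp (N + y * I) - h u * exp u) / (exp (N + y * I) - exp u) := by
      field_simp; ring
    rw [this, norm_div, div_le_iff₀ (by linarith)]
    rw [div_le_iff₀ hε] at h4
    calc ‖h (N + y * I) * exp (N + y * I) - h u * exp u‖
        ≤ ‖h (N + y * I)‖ * Real.exp N + ‖h u‖ * Real.exp u := by
          refine (norm_sub_le _ _).trans ?_
          rw [norm_mul, norm_mul, hw, hu]
      _ ≤ ε / 4 * Real.exp N + ‖h u‖ * Real.exp u := by gcongr; exact h1 y hy
      _ ≤ ε * (Real.exp N / 2) := by linarith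
      _ ≤ ε * ‖exp (N + y * I) - exp u‖ := by gcongr
  · intro h
    exact h2.ne' (by simpa using congrArg re h)

/-- Far to the left the factor `exp w` tends to `0` while `h` stays bounded and the denominator
stays away from `0`. -/
theorem tendsto_left_edge {h : ℂ → ℂ} (hh : DifferentiableOn ℂ h logStrip) (u : ℝ) {C : ℝ}
    (hbdd : ∀ᶠ x : ℝ in atBot, ∀ y : ℝ, |y| ≤ Real.pi → ‖h (x + y * I)‖ ≤ C) :
    Tendsto (fun N : ℝ => ∫ y in (-Real.pi)..Real.pi, expSlope h u ((-N : ℝ) + y * I)) atTop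
      (𝓝 0) := by
  have := tendsto_edge_integral (F := fun N y => expSlope h u ((-N : ℝ) + y * I)) (L := 0)
    (fun N => continuousOn_expSlope_edge hh u (-N)) fun ε hε => ?_
  · simpa using this
  have hlim : Tendsto (fun N : ℝ => (C + ‖h u‖) * Real.exp (-N)) atTop (𝓝 0) := by
    simpa using Real.tendsto_exp_neg_atTop_nhds_zero.const_mul (C + ‖h u‖)
  have hu0 := Real.exp_pos u
  filter_upwards [tendsto_neg_atTop_atBot.eventually hbdd, eventually_gt_atTop (-u),
    Real.tendsto_exp_neg_atTop_nhds_zero.eventually_le_const (half_pos hu0),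
    hlim.eventually_le_const (show 0 < ε * (Real.exp u / 2) by positivity)]
    with N h1 h2 h3 h4 y hy
  have hw := norm_exp_add_mul_I (-N) y
  have hu : ‖exp (u : ℂ)‖ = Real.exp u := by simp [norm_exp]
  have hden : Real.exp u / 2 ≤ ‖exp ((-N : ℝ) + y * I) - exp u‖ := by
    have := norm_sub_norm_le (exp u) (exp ((-N : ℝ) + y * I))
    rw [hw, hu, norm_sub_rev] at this
    linarith
  rw [expSlope_of_ne]
  · rw [sub_zero, div_mul_eq_mul_div, norm_div, div_le_iff₀ (by linarith), norm_mul, hw]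
    calc ‖h ((-N : ℝ) + y * I) - h u‖ * Real.exp (-N)
        ≤ (C + ‖h u‖) * Real.exp (-N) := by
          gcongr
          exact (norm_sub_le _ _).trans (by gcongr; exact h1 y hy)
      _ ≤ ε * (Real.exp u / 2) := h4
      _ ≤ _ := by gcongr
  · intro h
    have := congrArg re h
    simp at this
    linarith

/-- Stieltjes representation, in logarithmic coordinates, of a function holomorphic on the slit
plane, bounded near `0` and vanishing at infinity, whose imaginary part is nonpositive on the
upper side of the slit. -/
theorem stieltjes_of_im_nonpos {h : ℂ → ℂ} (hh : DifferentiableOn ℂ h logStrip)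
    (hconj : ∀ x : ℝ, h (x + (-Real.pi : ℝ) * I) = (starRingEnd ℂ) (h (x + Real.pi * I)))
    (him : ∀ x : ℝ, (h (x + Real.pi * I)).im ≤ 0)
    (hdecay : ∀ ε > 0, ∀ᶠ x : ℝ in atTop, ∀ y : ℝ, |y| ≤ Real.pi → ‖h (x + y * I)‖ ≤ ε)
    {C : ℝ} (hbdd : ∀ᶠ x : ℝ in atBot, ∀ y : ℝ, |y| ≤ Real.pi → ‖h (x + y * I)‖ ≤ C) (u : ℝ) :
    Integrable (fun x : ℝ => -(h (x + Real.pi * I)).im / Real.pi *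
      (Real.exp x / (Real.exp x + Real.exp u))) ∧
    ((∫ x : ℝ, -(h (x + Real.pi * I)).im / Real.pi *
      (Real.exp x / (Real.exp x + Real.exp u)) : ℝ) : ℂ) = h u := by
  have hpi := Real.pi_pos
  set f : ℝ → ℝ := fun x => -(h (x + Real.pi * I)).im / Real.pi *
      (Real.exp x / (Real.exp x + Real.exp u)) with hf
  have hf0 (x : ℝ) : 0 ≤ f x := by
    have := him x
    refine mul_nonneg (div_nonneg (by linarith) hpi.le) (by positivity)
  have hcont : Continuous f := by
    have h1 : Continuous fun x : ℝ => h (x + Real.pi * I) :=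
      hh.continuousOn.comp_continuous (by fun_prop)
        fun x => add_mul_I_mem_logStrip (by rw [abs_of_pos hpi])
    have h2 : ∀ x : ℝ, Real.exp x + Real.exp u ≠ 0 := fun x => by positivity
    exact ((continuous_im.comp h1).neg.div_const _).mul
      (Real.continuous_exp.div (by fun_prop) h2)
  have hid (N : ℝ) : ((∫ x in (-N)..N, f x : ℝ) : ℂ) = (2 * Real.pi : ℂ)⁻¹ *
      ((∫ y in (-Real.pi)..Real.pi, expSlope h u ((-N : ℝ) + y * I)) -
        ∫ y in (-Real.pi)..Real.pi, expSlope h u (N + y * I)) := by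
    have key := expSlope_boundary_integral hh u N
    have h1 (x : ℝ) : expSlope h u (x + (-Real.pi : ℝ) * I) - expSlope h u (x + Real.pi * I) =
        (2 * Real.pi * I) * (f x : ℂ) := by
      rw [expSlope_bottom_sub_top hconj, hf]
      have : (Real.pi : ℂ) ≠ 0 := ofReal_ne_zero.2 hpi.ne'
      push_cast
      field_simp
    simp only [h1, intervalIntegral.integral_const_mul, intervalIntegral.integral_ofReal] at key
    have hne : (2 * Real.pi : ℂ) ≠ 0 := by simp [hpi.ne']
    rw [eq_inv_mul_iff_mul_eq₀ hne]
    refine mul_left_cancel₀ I_ne_zero ?_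
    linear_combination key
  have hlimC : Tendsto (fun N : ℝ => ((∫ x in (-N)..N, f x : ℝ) : ℂ)) atTop (𝓝 (h u)) := by
    simp only [hid]
    have := ((tendsto_left_edge hh u hbdd).sub (tendsto_right_edge hh u hdecay)).const_mul
      ((2 * Real.pi : ℂ)⁻¹)
    convert this using 2
    have : (Real.pi : ℂ) ≠ 0 := ofReal_ne_zero.2 hpi.ne'
    field_simp
    ring
  have hlim : Tendsto (fun N : ℝ => ∫ x in (-N)..N, f x) atTop (𝓝 (h u).re) := by
    exact (continuous_re.tendsto _).comp hlimC
  -- As `f ≥ 0`, convergence of the integrals over `(-N, N)` already gives integrability.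
  have hint : Integrable f := by
    refine integrable_of_intervalIntegral_norm_tendsto (a := fun N : ℝ => -N) (b := id) (h u).re
      (fun N => (hcont.integrableOn_Icc).mono_set Ioc_subset_Icc_self)
      tendsto_neg_atTop_atBot tendsto_id ?_
    simpa only [Real.norm_of_nonneg (hf0 _), id] using hlim
  refine ⟨hint, ?_⟩
  have := intervalIntegral_tendsto_integral hint tendsto_neg_atTop_atBot tendsto_id
  exact tendsto_nhds_unique ((continuous_ofReal.tendsto _).comp this) hlimC

end Stieltjes

/-! ### The symbol and its spectral density -/

section Symbol

open Complex

variable {m : ℕ} {α : ℝ} {a b : Fin m → ℝ} {lam : ℝ}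

/-- The symbol `s ^ α + λ + ∑ b_i s ^ α_i` in the logarithmic coordinate `w = log s`. -/
noncomputable def logSymbol (α : ℝ) (a b : Fin m → ℝ) (lam : ℝ) (w : ℂ) : ℂ :=
  exp (α * w) + lam + ∑ i, b i * exp (a i * w)

theorem differentiable_logSymbol : Differentiable ℂ (logSymbol α a b lam) := by
  unfold logSymbol
  fun_prop

theorem logSymbol_conj (w : ℂ) :
    logSymbol α a b lam ((starRingEnd ℂ) w) = (starRingEnd ℂ) (logSymbol α a b lam w) := by
  simp [logSymbol, ← exp_conj]

theorem im_exp_ofReal_mul (c : ℝ) (w : ℂ) :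
    (exp (c * w)).im = Real.exp (c * w.re) * Real.sin (c * w.im) := by
  simp [exp_im]

/-- For `0 < c < 1` the angle `c * w.im` lies strictly inside `(0, π)`, even on the edge `w.im = π`,
so every exponential has positive imaginary part; `lam` is real. -/
theorem logSymbol_im_pos (hα₀ : 0 < α) (hα₁ : α < 1) (ha₀ : ∀ i, 0 < a i) (ha₁ : ∀ i, a i < α)
    (hb : ∀ i, 0 < b i) {w : ℂ} (hw₀ : 0 < w.im) (hw₁ : w.im ≤ Real.pi) :
    0 < (logSymbol α a b lam w).im := by
  have hsin {c : ℝ} (hc₀ : 0 < c) (hc₁ : c < 1) : 0 < (exp (c * w)).im := by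
    rw [im_exp_ofReal_mul]
    exact mul_pos (Real.exp_pos _) (Real.sin_pos_of_pos_of_lt_pi (by positivity) (by nlinarith))
  simp only [logSymbol, add_im, ofReal_im, im_sum, im_ofReal_mul, add_zero]
  have : 0 ≤ ∑ i, b i * (exp (a i * w)).im :=
    Finset.sum_nonneg fun i _ => (mul_pos (hb i) (hsin (ha₀ i) ((ha₁ i).trans hα₁))).le
  linarith [hsin hα₀ hα₁]

theorem logSymbol_ofReal (x : ℝ) : logSymbol α a b lam x =
    ((Real.exp (α * x) + lam + ∑ i, b i * Real.exp (a i * x) : ℝ) : ℂ) := by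
  simp [logSymbol]

theorem logSymbol_ne_zero (hα₀ : 0 < α) (hα₁ : α < 1) (ha₀ : ∀ i, 0 < a i) (ha₁ : ∀ i, a i < α)
    (hb : ∀ i, 0 < b i) (hlam : 0 < lam) {w : ℂ} (hw : w ∈ logStrip) :
    logSymbol α a b lam w ≠ 0 := by
  obtain ⟨h1, h2⟩ := abs_le.1 (show |w.im| ≤ Real.pi from hw)
  rcases lt_trichotomy w.im 0 with h | h | h
  · intro h0
    have := logSymbol_im_pos (lam := lam) hα₀ hα₁ ha₀ ha₁ hb
      (w := (starRingEnd ℂ) w) (by simpa using h) (by simp; linarith)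
    rw [logSymbol_conj, h0] at this
    simp at this
  · have : w = (w.re : ℂ) := Complex.ext rfl (by simp [h])
    rw [this, logSymbol_ofReal, ofReal_ne_zero]
    have : 0 ≤ ∑ i, b i * Real.exp (a i * w.re) :=
      Finset.sum_nonneg fun i _ => (mul_pos (hb i) (Real.exp_pos _)).le
    positivity
  · intro h0
    have := logSymbol_im_pos (lam := lam) hα₀ hα₁ ha₀ ha₁ hb h h2
    rw [h0] at this
    simp at this

theorem norm_exp_ofReal_mul_add (c x y : ℝ) : ‖exp (c * (x + y * I))‖ = Real.exp (c * x) := by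
  simp [norm_exp]

/-- Since `a i < α`, the other terms are eventually at most half of the leading one, uniformly in
`y`. -/
theorem logSymbol_inv_decay (hα₀ : 0 < α) (ha₁ : ∀ i, a i < α) (hb : ∀ i, 0 < b i) (hlam : 0 < lam)
    {ε : ℝ} (hε : 0 < ε) :
    ∀ᶠ x : ℝ in atTop, ∀ y : ℝ, |y| ≤ Real.pi → ‖(logSymbol α a b lam (x + y * I))⁻¹‖ ≤ ε := by
  have hexp {c : ℝ} (hc : 0 < c) : Tendsto (fun x : ℝ => Real.exp (c * x)) atTop atTop :=
    Real.tendsto_exp_atTop.comp (tendsto_id.const_mul_atTop hc)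
  have hlim : Tendsto (fun x : ℝ => lam * Real.exp (-(α * x)) +
      ∑ i, b i * Real.exp (-((α - a i) * x))) atTop (𝓝 0) := by
    have h1 {c : ℝ} (hc : 0 < c) : Tendsto (fun x : ℝ => Real.exp (-(c * x))) atTop (𝓝 0) :=
      Real.tendsto_exp_neg_atTop_nhds_zero.comp (tendsto_id.const_mul_atTop hc)
    have := ((h1 hα₀).const_mul lam).add (tendsto_finsetSum Finset.univ
      fun i _ => (h1 (sub_pos.2 (ha₁ i))).const_mul (b i))
    simpa using this
  filter_upwards [hlim.eventually_le_const (show (0 : ℝ) < 1 / 2 by norm_num),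
    (hexp hα₀).eventually_ge_atTop (2 / ε)] with x h1 h2 y _
  have hge : Real.exp (α * x) / 2 ≤ ‖logSymbol α a b lam (x + y * I)‖ := by
    have h3 : ‖(lam : ℂ) + ∑ i, b i * exp (a i * (x + y * I))‖ ≤ Real.exp (α * x) *
        (lam * Real.exp (-(α * x)) + ∑ i, b i * Real.exp (-((α - a i) * x))) := by
      refine (norm_add_le _ _).trans ?_
      rw [mul_add, Finset.mul_sum]
      refine add_le_add (le_of_eq ?_) ((norm_sum_le _ _).trans (Finset.sum_le_sum fun i _ => ?_))
      · rw [norm_real, Real.norm_of_nonneg hlam.le, mul_left_comm, ← Real.exp_add]; simp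
      · rw [norm_mul, norm_exp_ofReal_mul_add, norm_real, Real.norm_of_nonneg (hb i).le,
          mul_left_comm, ← Real.exp_add]
        ring_nf; rfl
    have h4 := norm_sub_le (logSymbol α a b lam (x + y * I))
      ((lam : ℂ) + ∑ i, b i * exp (a i * (x + y * I)))
    rw [logSymbol, add_assoc, add_sub_cancel_right, norm_exp_ofReal_mul_add, ← add_assoc] at h4
    have h5 := mul_le_mul_of_nonneg_left h1 (Real.exp_pos (α * x)).le
    rw [logSymbol]
    linarith
  rw [norm_inv]
  rw [div_le_iff₀ hε] at h2
  have := Real.exp_pos (α * x)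
  refine inv_le_of_inv_le₀ hε ((?_ : ε⁻¹ ≤ Real.exp (α * x) / 2).trans hge)
  rw [inv_le_iff_one_le_mul₀ hε]
  linarith

theorem logSymbol_inv_bounded (hα₀ : 0 < α) (ha₀ : ∀ i, 0 < a i) (hb : ∀ i, 0 < b i)
    (hlam : 0 < lam) :
    ∀ᶠ x : ℝ in atBot, ∀ y : ℝ, |y| ≤ Real.pi →
      ‖(logSymbol α a b lam (x + y * I))⁻¹‖ ≤ 2 / lam := by
  have hlim : Tendsto (fun x : ℝ => Real.exp (α * x) + ∑ i, b i * Real.exp (a i * x)) atBot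
      (𝓝 0) := by
    have h1 {c : ℝ} (hc : 0 < c) : Tendsto (fun x : ℝ => Real.exp (c * x)) atBot (𝓝 0) :=
      Real.tendsto_exp_atBot.comp (tendsto_id.const_mul_atBot hc)
    simpa using (h1 hα₀).add (tendsto_finsetSum Finset.univ
      fun i _ => (h1 (ha₀ i)).const_mul (b i))
  filter_upwards [hlim.eventually_le_const (half_pos hlam)] with x h1 y _
  have h3 : ‖exp (α * (x + y * I)) + ∑ i, b i * exp (a i * (x + y * I))‖ ≤
      Real.exp (α * x) + ∑ i, b i * Real.exp (a i * x) := by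
    refine (norm_add_le _ _).trans (add_le_add (norm_exp_ofReal_mul_add _ _ _).le
      ((norm_sum_le _ _).trans (Finset.sum_le_sum fun i _ => ?_)))
    rw [norm_mul, norm_exp_ofReal_mul_add, norm_real, Real.norm_of_nonneg (hb i).le]
  have h4 := norm_sub_le (logSymbol α a b lam (x + y * I))
    (exp (α * (x + y * I)) + ∑ i, b i * exp (a i * (x + y * I)))
  have h5 : logSymbol α a b lam (x + y * I) -
    (exp (α * (x + y * I)) + ∑ i, b i * exp (a i * (x + y * I))) = lam := by
    rw [logSymbol]; ring
  rw [h5, norm_real, Real.norm_of_nonneg hlam.le] at h4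
  rw [norm_inv, ← inv_div]
  exact inv_anti₀ (by positivity) (by linarith)

/-- The spectral density of the kernel, in the logarithmic coordinate. -/
noncomputable def spectralDensity (α : ℝ) (a b : Fin m → ℝ) (lam x : ℝ) : ℝ :=
  -((logSymbol α a b lam (x + Real.pi * I))⁻¹).im / Real.pi

theorem spectralDensity_pos (hα₀ : 0 < α) (hα₁ : α < 1) (ha₀ : ∀ i, 0 < a i)
    (ha₁ : ∀ i, a i < α) (hb : ∀ i, 0 < b i) (x : ℝ) : 0 < spectralDensity α a b lam x := by
  have h := logSymbol_im_pos (lam := lam) hα₀ hα₁ ha₀ ha₁ hb (w := x + Real.pi * I)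
    (by simpa using Real.pi_pos) (by simp)
  simp only [spectralDensity, inv_im, neg_div, neg_neg]
  have hne : logSymbol α a b lam (x + Real.pi * I) ≠ 0 := fun h0 => by simp [h0] at h
  exact div_pos (div_pos h (normSq_pos.2 hne)) Real.pi_pos

theorem stieltjes_inv_symbol (hα₀ : 0 < α) (hα₁ : α < 1) (ha₀ : ∀ i, 0 < a i)
    (ha₁ : ∀ i, a i < α) (hb : ∀ i, 0 < b i) (hlam : 0 < lam) {s : ℝ} (hs : 0 < s) :
    Integrable (fun x : ℝ => spectralDensity α a b lam x * (Real.exp x / (Real.exp x + s))) ∧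
    ∫ x : ℝ, spectralDensity α a b lam x * (Real.exp x / (Real.exp x + s)) =
      (s ^ α + lam + ∑ i, b i * s ^ a i)⁻¹ := by
  have hd : DifferentiableOn ℂ (fun w => (logSymbol α a b lam w)⁻¹) logStrip :=
    differentiable_logSymbol.differentiableOn.inv
      fun w hw => logSymbol_ne_zero hα₀ hα₁ ha₀ ha₁ hb hlam hw
  obtain ⟨h1, h2⟩ := stieltjes_of_im_nonpos hd (fun x => by
      rw [map_inv₀, ← logSymbol_conj]; simp) (fun x => by
      have := spectralDensity_pos (lam := lam) hα₀ hα₁ ha₀ ha₁ hb x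
      rw [spectralDensity, lt_div_iff₀ Real.pi_pos] at this
      linarith)
    (fun ε hε => logSymbol_inv_decay hα₀ ha₁ hb hlam hε)
    (logSymbol_inv_bounded hα₀ ha₀ hb hlam) (Real.log s)
  rw [Real.exp_log hs] at h1 h2
  refine ⟨h1, ofReal_injective (h2.trans ?_)⟩
  rw [logSymbol_ofReal, ← ofReal_inv]
  simp only [Real.rpow_def_of_pos hs, mul_comm]

end Symbol

/-! ### Termwise integration of series -/

section TermwiseIntegration

variable {Ω ι : Type*} [MeasurableSpace Ω] {μ : Measure Ω} {F : ι → Ω → ℝ}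

theorem tsum_lintegral_enorm_ne_top (hF_int : ∀ i, Integrable (F i) μ)
    (hF_sum : Summable fun i => ∫ x, ‖F i x‖ ∂μ) : ∑' i, ∫⁻ x, ‖F i x‖ₑ ∂μ ≠ ⊤ := by
  have h (i : ι) : ∫⁻ x, ‖F i x‖ₑ ∂μ = ENNReal.ofReal (∫ x, ‖F i x‖ ∂μ) :=
    (ofReal_integral_norm_eq_lintegral_enorm (hF_int i)).symm
  simp only [h]
  exact hF_sum.tsum_ofReal_ne_top

theorem ae_summable_of_summable_integral_norm [Countable ι] (hF_int : ∀ i, Integrable (F i) μ)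
    (hF_sum : Summable fun i => ∫ x, ‖F i x‖ ∂μ) : ∀ᵐ x ∂μ, Summable fun i => F i x := by
  have := summable_norm_of_tsum_eLpNorm_ne_top le_rfl (fun i => (hF_int i).1)
    (by simpa only [eLpNorm_one_eq_lintegral_enorm] using
      tsum_lintegral_enorm_ne_top hF_int hF_sum)
  filter_upwards [this] with x hx using hx.of_norm

theorem integrable_tsum_of_summable_integral_norm [Countable ι]
    (hF_int : ∀ i, Integrable (F i) μ) (hF_sum : Summable fun i => ∫ x, ‖F i x‖ ∂μ)
    (hm : AEStronglyMeasurable (fun x => ∑' i, F i x) μ) :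
    Integrable (fun x => ∑' i, F i x) μ := by
  refine ⟨hm, lt_of_le_of_lt (lintegral_mono fun x => enorm_tsum_le_tsum_enorm) ?_⟩
  rw [lintegral_tsum fun i => (hF_int i).1.enorm]
  exact (tsum_lintegral_enorm_ne_top hF_int hF_sum).lt_top

end TermwiseIntegration

/-! ### Convergence and Laplace transform of the multinomial series -/

section Series

variable {n : ℕ} {β : Fin n → ℝ} {β₀ : ℝ} {c : Fin n → ℝ}

theorem multinomialMLTerm_neg (z : Fin n → ℝ) (k : ℕ) :
    multinomialMLTerm β β₀ (fun i => -z i) k = (-1) ^ k * multinomialMLTerm β β₀ z k := by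
  simp only [multinomialMLTerm, Finset.mul_sum]
  refine Finset.sum_congr rfl fun l hl => ?_
  rw [Finset.mem_piAntidiag] at hl
  have : ∏ i, (-z i) ^ l i = (-1) ^ k * ∏ i, z i ^ l i := by
    simp only [neg_pow (z _), Finset.prod_mul_distrib, Finset.prod_pow_eq_pow_sum, hl.1]
  rw [this]
  ring

theorem add_sum_mul_pos (hβ : ∀ i, 0 < β i) (hβ₀ : 0 < β₀) (l : Fin n → ℕ) :
    0 < β₀ + ∑ i, β i * (l i : ℝ) :=
  add_pos_of_pos_of_nonneg hβ₀
    (Finset.sum_nonneg fun i _ => mul_nonneg (hβ i).le (Nat.cast_nonneg _))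

theorem multinomialMLTerm_mono (hβ : ∀ i, 0 < β i) (hβ₀ : 0 < β₀) {z z' : Fin n → ℝ}
    (hz : ∀ i, 0 ≤ z i) (hzz' : ∀ i, z i ≤ z' i) (k : ℕ) :
    multinomialMLTerm β β₀ z k ≤ multinomialMLTerm β β₀ z' k := by
  refine Finset.sum_le_sum fun l _ => ?_
  have hΓ := Real.Gamma_pos_of_pos (add_sum_mul_pos hβ hβ₀ l)
  have : ∏ i, z i ^ l i ≤ ∏ i, z' i ^ l i :=
    Finset.prod_le_prod (fun i _ => pow_nonneg (hz i) _)
      fun i _ => pow_le_pow_left₀ (hz i) (hzz' i) _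
  simp only [RCLike.ofReal_real_eq_id, id]
  gcongr

theorem multinomialMLTerm_nonneg (hβ : ∀ i, 0 < β i) (hβ₀ : 0 < β₀) {z : Fin n → ℝ}
    (hz : ∀ i, 0 ≤ z i) (k : ℕ) : 0 ≤ multinomialMLTerm β β₀ z k := by
  refine Finset.sum_nonneg fun l _ => ?_
  have hΓ := Real.Gamma_pos_of_pos (add_sum_mul_pos hβ hβ₀ l)
  have : 0 ≤ ∏ i, z i ^ l i := Finset.prod_nonneg fun i _ => pow_nonneg (hz i) _
  simp only [RCLike.ofReal_real_eq_id, id]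
  positivity

theorem rpow_mul_multinomialMLTerm {t : ℝ} (ht : 0 < t) (k : ℕ) :
    t ^ (β₀ - 1) * multinomialMLTerm β β₀ (fun i => c i * t ^ β i) k =
      ∑ l ∈ Finset.piAntidiag (Finset.univ : Finset (Fin n)) k,
        (Nat.multinomial Finset.univ l : ℝ) * (∏ i, c i ^ l i) /
          Real.Gamma (β₀ + ∑ i, β i * (l i : ℝ)) * t ^ (β₀ + ∑ i, β i * (l i : ℝ) - 1) := by
  simp only [multinomialMLTerm, Finset.mul_sum, RCLike.ofReal_real_eq_id, id]
  refine Finset.sum_congr rfl fun l _ => ?_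
  have h1 : ∏ i, (c i * t ^ β i) ^ l i = (∏ i, c i ^ l i) * t ^ (∑ i, β i * (l i : ℝ)) := by
    rw [Real.rpow_sum_of_pos ht, ← Finset.prod_mul_distrib]
    refine Finset.prod_congr rfl fun i _ => ?_
    rw [mul_pow, Real.rpow_mul_natCast ht.le]
  rw [h1, show β₀ + ∑ i, β i * (l i : ℝ) - 1 = (β₀ - 1) + ∑ i, β i * (l i : ℝ) by ring,
    Real.rpow_add ht]
  ring

theorem integrableOn_exp_neg_mul_rpow {r s : ℝ} (hr : 0 < r) (hs : 0 < s) :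
    IntegrableOn (fun t : ℝ => t ^ (r - 1) * Real.exp (-(s * t))) (Ioi 0) := by
  refine Integrable.of_integral_ne_zero ?_
  rw [Real.integral_rpow_mul_exp_neg_mul_Ioi hr hs]
  have := Real.Gamma_pos_of_pos hr
  positivity

/-- The transform of `t^(r-1)` is `Γ(r) s^(-r)`, so the Gamma factors cancel and the multinomial
theorem reassembles a `k`-th power. -/
theorem laplace_multinomialMLTerm (hβ : ∀ i, 0 < β i) (hβ₀ : 0 < β₀) {s : ℝ} (hs : 0 < s)
    (k : ℕ) :
    IntegrableOn (fun t => Real.exp (-(s * t)) *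
      (t ^ (β₀ - 1) * multinomialMLTerm β β₀ (fun i => c i * t ^ β i) k)) (Ioi 0) ∧
    ∫ t in Ioi (0 : ℝ), Real.exp (-(s * t)) *
      (t ^ (β₀ - 1) * multinomialMLTerm β β₀ (fun i => c i * t ^ β i) k) =
      (1 / s) ^ β₀ * (∑ i, c i * (1 / s) ^ β i) ^ k := by
  have hs' : 0 < 1 / s := by positivity
  have heq : EqOn (fun t => Real.exp (-(s * t)) *
      (t ^ (β₀ - 1) * multinomialMLTerm β β₀ (fun i => c i * t ^ β i) k))
      (fun t => ∑ l ∈ Finset.piAntidiag (Finset.univ : Finset (Fin n)) k,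
        (Nat.multinomial Finset.univ l : ℝ) * (∏ i, c i ^ l i) /
          Real.Gamma (β₀ + ∑ i, β i * (l i : ℝ)) *
          (t ^ (β₀ + ∑ i, β i * (l i : ℝ) - 1) * Real.exp (-(s * t)))) (Ioi 0) := by
    intro t ht
    simp only [rpow_mul_multinomialMLTerm (show 0 < t from ht), Finset.mul_sum]
    exact Finset.sum_congr rfl fun l _ => by ring
  have hint (l : Fin n → ℕ) :=
    (integrableOn_exp_neg_mul_rpow (add_sum_mul_pos hβ hβ₀ l) hs).const_mul
      ((Nat.multinomial Finset.univ l : ℝ) * (∏ i, c i ^ l i) /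
          Real.Gamma (β₀ + ∑ i, β i * (l i : ℝ)))
  constructor
  · exact IntegrableOn.congr_fun (integrable_finsetSum _ fun l _ => hint l) heq.symm
      measurableSet_Ioi
  · rw [setIntegral_congr_fun measurableSet_Ioi heq, integral_finsetSum _ fun l _ => hint l,
      Finset.sum_pow_eq_sum_piAntidiag, Finset.mul_sum]
    refine Finset.sum_congr rfl fun l _ => ?_
    have hΓ := (Real.Gamma_pos_of_pos (add_sum_mul_pos hβ hβ₀ l)).ne'
    have h1 : ∏ i, (c i * (1 / s) ^ β i) ^ l i =
        (∏ i, c i ^ l i) * (1 / s) ^ (∑ i, β i * (l i : ℝ)) := by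
      rw [Real.rpow_sum_of_pos hs', ← Finset.prod_mul_distrib]
      refine Finset.prod_congr rfl fun i _ => ?_
      rw [mul_pow, Real.rpow_mul_natCast hs'.le]
    rw [integral_const_mul, Real.integral_rpow_mul_exp_neg_mul_Ioi (add_sum_mul_pos hβ hβ₀ l) hs,
      h1, Real.rpow_add hs']
    field_simp

theorem exists_forall_sum_rpow_lt_one (hβ : ∀ i, 0 < β i) (c : Fin n → ℝ) :
    ∃ s₀ > 0, ∀ s, s₀ ≤ s → ∑ i, c i * (1 / s) ^ β i < 1 := by
  have hlim : Tendsto (fun s : ℝ => ∑ i, c i * (1 / s) ^ β i) atTop (𝓝 0) := by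
    have h (i : Fin n) : Tendsto (fun s : ℝ => c i * (1 / s) ^ β i) atTop (𝓝 0) := by
      have : Tendsto (fun s : ℝ => (1 / s) ^ β i) atTop (𝓝 0) := by
        refine (tendsto_rpow_neg_atTop (hβ i)).congr' ?_
        filter_upwards [eventually_ge_atTop 0] with s hs
        rw [one_div, Real.inv_rpow hs, Real.rpow_neg hs]
      simpa using this.const_mul (c i)
    simpa using tendsto_finsetSum Finset.univ fun i _ => h i
  obtain ⟨s₀, h⟩ := eventually_atTop.1 (hlim.eventually_lt_const one_pos)
  exact ⟨max s₀ 1, by positivity, fun s hs => h s ((le_max_left _ _).trans hs)⟩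

theorem summable_integral_norm_multinomialMLTerm (hβ : ∀ i, 0 < β i) (hβ₀ : 0 < β₀)
    (hc : ∀ i, 0 < c i) {s : ℝ} (hs : 0 < s) (hs₁ : ∑ i, c i * (1 / s) ^ β i < 1) :
    Summable fun k => ∫ t in Ioi (0 : ℝ), ‖Real.exp (-(s * t)) *
      (t ^ (β₀ - 1) * multinomialMLTerm β β₀ (fun i => c i * t ^ β i) k)‖ := by
  have h0 : 0 ≤ ∑ i, c i * (1 / s) ^ β i :=
    Finset.sum_nonneg fun i _ => mul_nonneg (hc i).le (by positivity)
  refine ((summable_geometric_of_lt_one h0 hs₁).mul_left ((1 / s) ^ β₀)).congr fun k => ?_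
  rw [← (laplace_multinomialMLTerm hβ hβ₀ hs k).2]
  refine setIntegral_congr_fun measurableSet_Ioi fun t ht => ?_
  have ht : 0 < t := ht
  refine (Real.norm_of_nonneg ?_).symm
  have := multinomialMLTerm_nonneg hβ hβ₀ (z := fun i => c i * t ^ β i)
    (fun i => mul_nonneg (hc i).le (by positivity)) k
  positivity

/-- No growth estimate for Γ is needed: for large `s` the transforms form a convergent geometric
series, so the series converges at almost every `τ`. Some such `τ` exceeds `t`, and the terms
increase with the argument. -/
theorem summable_multinomialMLTerm (hβ : ∀ i, 0 < β i) (hβ₀ : 0 < β₀) (hc : ∀ i, 0 < c i) {t : ℝ}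
    (ht : 0 < t) : Summable (multinomialMLTerm β β₀ fun i => c i * t ^ β i) := by
  obtain ⟨s, hs, hs₁⟩ := exists_forall_sum_rpow_lt_one hβ c
  have hae : ∀ᵐ τ ∂(volume.restrict (Ioi (0 : ℝ))), Summable fun k => Real.exp (-(s * τ)) *
      (τ ^ (β₀ - 1) * multinomialMLTerm β β₀ (fun i => c i * τ ^ β i) k) :=
    ae_summable_of_summable_integral_norm (fun k => (laplace_multinomialMLTerm hβ hβ₀ hs k).1)
      (summable_integral_norm_multinomialMLTerm hβ hβ₀ hc hs (hs₁ s le_rfl))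
  obtain ⟨τ, hτ, hsum⟩ : ∃ τ, t < τ ∧ Summable fun k => Real.exp (-(s * τ)) *
      (τ ^ (β₀ - 1) * multinomialMLTerm β β₀ (fun i => c i * τ ^ β i) k) := by
    by_contra! hcon
    have : volume.restrict (Ioi (0 : ℝ)) (Ioi t) = 0 :=
      measure_mono_null (fun τ hτ => hcon τ hτ) (ae_iff.1 hae)
    rw [Measure.restrict_apply measurableSet_Ioi, Ioi_inter_Ioi, sup_eq_left.2 ht.le] at this
    simp at this
  have hτ0 := ht.trans hτ
  have hsum' := (summable_mul_left_iff (Real.rpow_pos_of_pos hτ0 _).ne').1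
    ((summable_mul_left_iff (Real.exp_pos _).ne').1 hsum)
  have hz (i : Fin n) : 0 ≤ c i * t ^ β i := mul_nonneg (hc i).le (by positivity)
  exact hsum'.of_nonneg_of_le (fun k => multinomialMLTerm_nonneg hβ hβ₀ hz k) fun k =>
    multinomialMLTerm_mono hβ hβ₀ hz (fun i => mul_le_mul_of_nonneg_left
      (Real.rpow_le_rpow ht.le hτ.le (hβ i).le) (hc i).le) k

theorem summable_multinomialMLTerm_neg (hβ : ∀ i, 0 < β i) (hβ₀ : 0 < β₀) (hc : ∀ i, 0 < c i)
    {t : ℝ} (ht : 0 < t) : Summable (multinomialMLTerm β β₀ fun i => -(c i * t ^ β i)) := by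
  refine Summable.of_norm_bounded (summable_multinomialMLTerm hβ hβ₀ hc ht) fun k => ?_
  rw [multinomialMLTerm_neg, norm_mul, norm_pow, norm_neg, norm_one, one_pow, one_mul,
    Real.norm_of_nonneg (multinomialMLTerm_nonneg hβ hβ₀
      (fun i => mul_nonneg (hc i).le (by positivity)) k)]

theorem continuousOn_multinomialML (hβ : ∀ i, 0 < β i) (hβ₀ : 0 < β₀) (hc : ∀ i, 0 < c i) :
    ContinuousOn (fun t => multinomialML β β₀ fun i => -(c i * t ^ β i)) (Ioi 0) := by
  intro t ht
  have ht : 0 < t := ht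
  refine ContinuousAt.continuousWithinAt ?_
  have hon : ContinuousOn (fun τ => multinomialML β β₀ fun i => -(c i * τ ^ β i))
      (Ioo 0 (t + 1)) := by
    unfold multinomialML
    -- Weierstrass test: on `(0, t + 1)` the terms are dominated by the nonnegative series at `t +
    -- 1`.
    refine continuousOn_tsum (u := multinomialMLTerm β β₀ fun i => c i * (t + 1) ^ β i)
      (fun k => ?_) (summable_multinomialMLTerm hβ hβ₀ hc (by linarith)) fun k τ hτ => ?_
    · unfold multinomialMLTerm
      refine continuousOn_finsetSum _ fun l _ => continuousOn_const.mul (ContinuousOn.div_const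
        (continuousOn_finsetProd _ fun i _ => ContinuousOn.pow (ContinuousOn.neg
          (continuousOn_const.mul (continuousOn_id.rpow_const fun τ hτ => Or.inl hτ.1.ne'))) _) _)
    · have hz (i : Fin n) : 0 ≤ c i * τ ^ β i :=
        mul_nonneg (hc i).le (Real.rpow_nonneg hτ.1.le _)
      rw [multinomialMLTerm_neg, norm_mul, norm_pow, norm_neg, norm_one, one_pow, one_mul,
        Real.norm_of_nonneg (multinomialMLTerm_nonneg hβ hβ₀ hz k)]
      exact multinomialMLTerm_mono hβ hβ₀ hz (fun i => mul_le_mul_of_nonneg_left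
        (Real.rpow_le_rpow hτ.1.le hτ.2.le (hβ i).le) (hc i).le) k
  exact hon.continuousAt (Ioo_mem_nhds ht (by linarith))

theorem laplace_multinomialML (hβ : ∀ i, 0 < β i) (hβ₀ : 0 < β₀) (hc : ∀ i, 0 < c i) {s : ℝ}
    (hs : 0 < s) (hs₁ : ∑ i, c i * (1 / s) ^ β i < 1) :
    IntegrableOn (fun t => Real.exp (-(s * t)) *
      (t ^ (β₀ - 1) * multinomialML β β₀ fun i => -(c i * t ^ β i))) (Ioi 0) ∧
    ∫ t in Ioi (0 : ℝ), Real.exp (-(s * t)) *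
      (t ^ (β₀ - 1) * multinomialML β β₀ fun i => -(c i * t ^ β i)) =
      (1 / s) ^ β₀ / (1 + ∑ i, c i * (1 / s) ^ β i) := by
  have h0 : 0 ≤ ∑ i, c i * (1 / s) ^ β i :=
    Finset.sum_nonneg fun i _ => mul_nonneg (hc i).le (by positivity)
  set F : ℕ → ℝ → ℝ := fun k t => Real.exp (-(s * t)) *
    (t ^ (β₀ - 1) * multinomialMLTerm β β₀ (fun i => -(c i * t ^ β i)) k) with hF
  have hFeq (k : ℕ) (t : ℝ) : F k t = (-1) ^ k * (Real.exp (-(s * t)) *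
      (t ^ (β₀ - 1) * multinomialMLTerm β β₀ (fun i => c i * t ^ β i) k)) := by
    simp only [hF, multinomialMLTerm_neg]
    ring
  have hFi (k : ℕ) : IntegrableOn (F k) (Ioi 0) := by
    simp only [funext (hFeq k)]
    exact (laplace_multinomialMLTerm hβ hβ₀ hs k).1.const_mul _
  have hFs : Summable fun k => ∫ t in Ioi (0 : ℝ), ‖F k t‖ := by
    refine (summable_integral_norm_multinomialMLTerm hβ hβ₀ hc hs hs₁).congr fun k => ?_
    simp [hFeq]
  have hFt (t : ℝ) : ∑' k, F k t = Real.exp (-(s * t)) *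
      (t ^ (β₀ - 1) * multinomialML β β₀ fun i => -(c i * t ^ β i)) := by
    simp only [hF, tsum_mul_left, multinomialML]
  have hm : AEStronglyMeasurable (fun t => ∑' k, F k t) (volume.restrict (Ioi 0)) := by
    simp only [hFt]
    refine ContinuousOn.aestronglyMeasurable ?_ measurableSet_Ioi
    exact (by fun_prop : Continuous fun t => Real.exp (-(s * t))).continuousOn.mul
      ((continuousOn_id.rpow_const fun t ht => Or.inl (ne_of_gt ht)).mul
        (continuousOn_multinomialML hβ hβ₀ hc))
  simp only [← hFt]
  refine ⟨integrable_tsum_of_summable_integral_norm hFi hFs hm, ?_⟩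
  rw [← integral_tsum_of_summable_integral_norm hFi hFs]
  have hint (k : ℕ) : ∫ t in Ioi (0 : ℝ), F k t =
      (1 / s) ^ β₀ * (-∑ i, c i * (1 / s) ^ β i) ^ k := by
    simp only [hFeq, integral_const_mul, (laplace_multinomialMLTerm hβ hβ₀ hs k).2]
    rw [neg_pow]
    ring
  simp only [hint, tsum_mul_left]
  rw [tsum_geometric_of_norm_lt_one (by rwa [norm_neg, Real.norm_of_nonneg h0]), sub_neg_eq_add]
  exact (div_eq_mul_inv _ _).symm

end Series

/-! ### The kernel as the Laplace transform of its spectral measure -/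

section Kernel

variable {m : ℕ} {α : ℝ} {a b : Fin m → ℝ} {lam : ℝ}

theorem kernelOrders_pos (hα₀ : 0 < α) (ha₁ : ∀ i, a i < α) (i : Fin (m + 1)) :
    0 < kernelOrders α a i := by
  refine Fin.cases hα₀ (fun j => ?_) i
  simpa [kernelOrders] using ha₁ j

theorem vecCons_pos (hlam : 0 < lam) (hb : ∀ i, 0 < b i) (i : Fin (m + 1)) :
    0 < Matrix.vecCons lam b i := by
  refine Fin.cases hlam (fun j => ?_) i
  simpa using hb j

theorem kernelArgs_eq (t : ℝ) : kernelArgs α a b lam t =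
    fun i => -(Matrix.vecCons lam b i * t ^ kernelOrders α a i) := by
  funext i
  refine Fin.cases ?_ (fun j => ?_) i <;> simp [kernelArgs, kernelOrders]

theorem scalarKernel_eq (t : ℝ) : scalarKernel α a b lam t = t ^ (α - 1) *
    multinomialML (kernelOrders α a) α
      fun i => -(Matrix.vecCons lam b i * t ^ kernelOrders α a i) := by
  rw [scalarKernel, kernelArgs_eq]

theorem continuousOn_scalarKernel (hα₀ : 0 < α) (ha₁ : ∀ i, a i < α) (hb : ∀ i, 0 < b i)
    (hlam : 0 < lam) : ContinuousOn (scalarKernel α a b lam) (Ioi 0) := by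
  simp only [funext (scalarKernel_eq (α := α) (a := a) (b := b) (lam := lam))]
  exact (continuousOn_id.rpow_const fun t ht => Or.inl (ne_of_gt ht)).mul
    (continuousOn_multinomialML (kernelOrders_pos hα₀ ha₁) hα₀ (vecCons_pos hlam hb))

theorem exists_laplace_scalarKernel (hα₀ : 0 < α) (ha₁ : ∀ i, a i < α) (hb : ∀ i, 0 < b i)
    (hlam : 0 < lam) : ∃ s₀ > 0, ∀ s, s₀ ≤ s →
    IntegrableOn (fun t => Real.exp (-(s * t)) * scalarKernel α a b lam t) (Ioi 0) ∧
    ∫ t in Ioi (0 : ℝ), Real.exp (-(s * t)) * scalarKernel α a b lam t =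
      (s ^ α + lam + ∑ i, b i * s ^ a i)⁻¹ := by
  have hβ := kernelOrders_pos hα₀ ha₁
  have hc := vecCons_pos hlam hb
  obtain ⟨s₀, hs₀, h⟩ := exists_forall_sum_rpow_lt_one hβ (Matrix.vecCons lam b)
  refine ⟨s₀, hs₀, fun s hs => ?_⟩
  have hs0 := hs₀.trans_le hs
  simp only [scalarKernel_eq]
  obtain ⟨h1, h2⟩ := laplace_multinomialML hβ hα₀ hc hs0 (h s hs)
  refine ⟨h1, h2.trans ?_⟩
  -- The orders `α - a i` are exactly those for which multiplication by `s ^ α` turns `s ^ (-(α - a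
  -- i))` into `s ^ a i`.
  have hsum : s ^ α * (1 + ∑ i, Matrix.vecCons lam b i * (1 / s) ^ kernelOrders α a i) =
      s ^ α + lam + ∑ i, b i * s ^ a i := by
    rw [Fin.sum_univ_succ, mul_add, mul_add, mul_one, ← add_assoc, Finset.mul_sum]
    congr 1
    · simp only [Matrix.cons_val_zero, kernelOrders, one_div, Real.inv_rpow hs0.le]
      have := (Real.rpow_pos_of_pos hs0 α).ne'
      field_simp
    · refine Finset.sum_congr rfl fun i _ => ?_
      simp only [Matrix.cons_val_succ, kernelOrders, one_div]
      rw [Real.inv_rpow hs0.le, ← Real.rpow_neg hs0.le, mul_left_comm, ← Real.rpow_add hs0]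
      congr 2
      ring
  rw [← hsum, mul_inv, one_div, Real.inv_rpow hs0.le, div_eq_mul_inv]

/-- The spectral measure of the kernel, in the logarithmic coordinate `x = log r`. -/
noncomputable def spectralMeasure (α : ℝ) (a b : Fin m → ℝ) (lam : ℝ) : Measure ℝ :=
  volume.withDensity fun x => ENNReal.ofReal (spectralDensity α a b lam x * Real.exp x)

instance : SFinite (spectralMeasure α a b lam) := by
  unfold spectralMeasure
  infer_instance

theorem continuous_spectralDensity (hα₀ : 0 < α) (hα₁ : α < 1) (ha₀ : ∀ i, 0 < a i)
    (ha₁ : ∀ i, a i < α) (hb : ∀ i, 0 < b i) (hlam : 0 < lam) :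
    Continuous (spectralDensity α a b lam) := by
  have h : Continuous fun x : ℝ => (logSymbol α a b lam (x + Real.pi * Complex.I))⁻¹ :=
    (differentiable_logSymbol.continuous.comp (by fun_prop)).inv₀ fun x =>
      logSymbol_ne_zero hα₀ hα₁ ha₀ ha₁ hb hlam
        (add_mul_I_mem_logStrip (by rw [abs_of_pos Real.pi_pos]))
  exact (Complex.continuous_im.comp h).neg.div_const _

theorem stieltjes_spectralMeasure (hα₀ : 0 < α) (hα₁ : α < 1) (ha₀ : ∀ i, 0 < a i)
    (ha₁ : ∀ i, a i < α) (hb : ∀ i, 0 < b i) (hlam : 0 < lam) {s : ℝ} (hs : 0 < s) :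
    Integrable (fun x => (s - -Real.exp x)⁻¹) (spectralMeasure α a b lam) ∧
    ∫ x, (s - -Real.exp x)⁻¹ ∂spectralMeasure α a b lam =
      (s ^ α + lam + ∑ i, b i * s ^ a i)⁻¹ := by
  obtain ⟨h1, h2⟩ := stieltjes_inv_symbol hα₀ hα₁ ha₀ ha₁ hb hlam hs
  have hm : Measurable fun x => ENNReal.ofReal (spectralDensity α a b lam x * Real.exp x) :=
    ((continuous_spectralDensity hα₀ hα₁ ha₀ ha₁ hb hlam).mul
      Real.continuous_exp).measurable.ennreal_ofReal
  have heq (x : ℝ) : (ENNReal.ofReal (spectralDensity α a b lam x * Real.exp x)).toReal •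
      (s - -Real.exp x)⁻¹ = spectralDensity α a b lam x * (Real.exp x / (Real.exp x + s)) := by
    rw [ENNReal.toReal_ofReal (mul_pos (spectralDensity_pos hα₀ hα₁ ha₀ ha₁ hb x)
      (Real.exp_pos x)).le, smul_eq_mul, sub_neg_eq_add, add_comm s]
    ring
  constructor
  · rw [spectralMeasure, integrable_withDensity_iff_integrable_smul' hm (by simp)]
    simpa only [heq] using h1
  · rw [spectralMeasure, integral_withDensity_eq_integral_toReal_smul hm (by simp)]
    simpa only [heq] using h2

/-- A zero measure would have zero Stieltjes transform. Nonvanishing is what makes the kernel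
strictly positive. -/
theorem spectralMeasure_ne_zero (hα₀ : 0 < α) (hα₁ : α < 1) (ha₀ : ∀ i, 0 < a i)
    (ha₁ : ∀ i, a i < α) (hb : ∀ i, 0 < b i) (hlam : 0 < lam) :
    spectralMeasure α a b lam ≠ 0 := by
  intro h
  have := (stieltjes_spectralMeasure hα₀ hα₁ ha₀ ha₁ hb hlam one_pos).2
  rw [h, integral_zero_measure, eq_comm, inv_eq_zero] at this
  have h0 : 0 ≤ ∑ i, b i * (1 : ℝ) ^ a i := Finset.sum_nonneg fun i _ => by
    simpa using (hb i).le
  rw [Real.one_rpow] at this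
  linarith

/-- The kernel is the Laplace transform of its spectral measure. -/
theorem scalarKernel_eq_mgf (hα₀ : 0 < α) (hα₁ : α < 1) (ha₀ : ∀ i, 0 < a i)
    (ha₁ : ∀ i, a i < α) (hb : ∀ i, 0 < b i) (hlam : 0 < lam) :
    EqOn (scalarKernel α a b lam)
      (mgf (fun x => -Real.exp x) (spectralMeasure α a b lam)) (Ioi 0) := by
  have hX : Measurable fun x : ℝ => -Real.exp x := by fun_prop
  have hneg (x : ℝ) : -Real.exp x < 0 := neg_neg_of_pos (Real.exp_pos x)
  have hst {s : ℝ} (hs : 0 < s) := stieltjes_spectralMeasure hα₀ hα₁ ha₀ ha₁ hb hlam hs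
  obtain ⟨s₀, hs₀, h⟩ := exists_laplace_scalarKernel hα₀ ha₁ hb hlam
  have hae : (fun t => scalarKernel α a b lam t -
      mgf (fun x => -Real.exp x) (spectralMeasure α a b lam) t) =ᵐ[volume.restrict (Ioi 0)] 0 := by
    refine ae_eq_zero_of_laplace_eq_zero (s₀ := s₀) (fun s hs => ?_) fun s hs => ?_
    · simp only [mul_sub]
      exact (h s hs).1.sub
        (integrableOn_exp_neg_mul_mgf hX hneg (hs₀.trans_le hs) (hst (hs₀.trans_le hs)).1)
    · simp only [mul_sub]
      rw [integral_sub (h s hs).1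
        (integrableOn_exp_neg_mul_mgf hX hneg (hs₀.trans_le hs) (hst (hs₀.trans_le hs)).1),
        (h s hs).2, integral_exp_neg_mul_mgf hX hneg (hs₀.trans_le hs) (hst (hs₀.trans_le hs)).1,
        (hst (hs₀.trans_le hs)).2, sub_self]
  -- Almost everywhere equality becomes equality everywhere because both functions are continuous on
  -- `(0, ∞)`.
  refine Measure.eqOn_open_of_ae_eq (μ := volume) ?_ isOpen_Ioi
    (continuousOn_scalarKernel hα₀ ha₁ hb hlam)
    (continuousOn_mgf.mono (Ioi_subset_interior_integrableExpSet hX hneg (hst one_pos).1))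
  filter_upwards [hae] with t ht
  exact sub_eq_zero.1 ht

theorem IsCompletelyMonotone.congr {f g : ℝ → ℝ} (hg : IsCompletelyMonotone g)
    (h : EqOn f g (Ioi 0)) : IsCompletelyMonotone f :=
  ⟨hg.1.congr h, fun n t ht => by
    rw [iteratedDerivWithin_congr h ht]
    exact hg.2 n t ht⟩

/-- A positive function on `(0, ∞)` whose Laplace transform is bounded by `M` has all its
integrals over `(0, T)` strictly below `M`. -/
theorem integral_lt_of_laplace_le {f : ℝ → ℝ} {M : ℝ} (hpos : ∀ t, 0 < t → 0 < f t)
    (hint : ∀ s, 0 < s → IntegrableOn (fun t => Real.exp (-(s * t)) * f t) (Ioi 0))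
    (hle : ∀ s, 0 < s → ∫ t in Ioi (0 : ℝ), Real.exp (-(s * t)) * f t ≤ M) {T : ℝ} (hT : 0 < T) :
    IntervalIntegrable f volume 0 T ∧ ∫ t in (0 : ℝ)..T, f t < M := by
  have hfi (R : ℝ) : IntegrableOn f (Ioc 0 R) := by
    have h1 : IntegrableOn (fun t => Real.exp (-(1 * t)) * f t) (Ioc 0 R) :=
      (hint 1 one_pos).mono_set Ioc_subset_Ioi_self
    have h2 : IntegrableOn (fun t => Real.exp t * (Real.exp (-(1 * t)) * f t)) (Ioc 0 R) :=
      h1.continuousOn_mul_of_subset Real.continuous_exp.continuousOn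
        isCompact_Icc measurableSet_Ioc Ioc_subset_Icc_self
    refine h2.congr_fun (fun t _ => ?_) measurableSet_Ioc
    simp only [← mul_assoc, ← Real.exp_add]
    simp
  have hii {A R : ℝ} (hA : 0 ≤ A) (hR : 0 ≤ R) : IntervalIntegrable f volume A R := by
    have h0 {R : ℝ} (hR : 0 ≤ R) : IntervalIntegrable f volume 0 R :=
      (intervalIntegrable_iff_integrableOn_Ioc_of_le hR).2 (hfi R)
    exact (h0 hA).symm.trans (h0 hR)
  have hbound {R : ℝ} (hR : 0 < R) : ∫ t in (0 : ℝ)..R, f t ≤ M := by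
    -- On `(0, R]` the weight `exp (-s t)` is at least `exp (-s R)`, which tends to `1` as `s → 0`.
    have hlim : Tendsto (fun s : ℝ => Real.exp (-(s * R)) * ∫ t in (0 : ℝ)..R, f t) (𝓝[>] 0)
        (𝓝 (∫ t in (0 : ℝ)..R, f t)) := by
      have : Continuous fun s : ℝ => Real.exp (-(s * R)) * ∫ t in (0 : ℝ)..R, f t := by fun_prop
      simpa using (this.tendsto 0).mono_left nhdsWithin_le_nhds
    refine le_of_tendsto hlim ?_
    filter_upwards [self_mem_nhdsWithin] with s hs
    have hs : 0 < s := hs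
    rw [intervalIntegral.integral_of_le hR.le, ← integral_const_mul]
    calc ∫ t in Ioc 0 R, Real.exp (-(s * R)) * f t
        ≤ ∫ t in Ioc 0 R, Real.exp (-(s * t)) * f t := by
          refine setIntegral_mono_on ((hfi R).const_mul _)
            ((hint s hs).mono_set Ioc_subset_Ioi_self) measurableSet_Ioc fun t ht => ?_
          have := hpos t ht.1
          have := ht.2
          gcongr
      _ ≤ ∫ t in Ioi 0, Real.exp (-(s * t)) * f t := by
          refine setIntegral_mono_set (hint s hs) ?_ Ioc_subset_Ioi_self.eventuallyLE
          filter_upwards [ae_restrict_mem measurableSet_Ioi] with t ht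
          exact (mul_pos (Real.exp_pos _) (hpos t ht)).le
      _ ≤ M := hle s hs
  refine ⟨hii le_rfl hT.le, ?_⟩
  -- Strictness: the bound `M` also holds up to `T + 1`, and the integral over `(T, T + 1)` is
  -- positive.
  have hT1 : (0 : ℝ) < T + 1 := by linarith
  have hpos' : 0 < ∫ t in T..(T + 1), f t :=
    intervalIntegral.intervalIntegral_pos_of_pos_on (hii hT.le hT1.le)
      (fun t ht => hpos t (hT.trans ht.1)) (by linarith)
  have := intervalIntegral.integral_add_adjacent_intervals (hii le_rfl hT.le) (hii hT.le hT1.le)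
  linarith [hbound hT1]

end Kernel

/- The first conjunct says that the series defining the kernel converges, so that the kernel is
the sum of its series and not a default value. -/
theorem lemma2p2 {m : ℕ} (α : ℝ) (hα₀ : 0 < α) (hα₁ : α < 1)
    (a : Fin m → ℝ) (ha₀ : ∀ i, 0 < a i) (ha₁ : ∀ i, a i < α)
    (b : Fin m → ℝ) (hb : ∀ i, 0 < b i) (lam : ℝ) (hlam : 0 < lam) :
    (∀ t : ℝ, 0 < t →
      Summable (multinomialMLTerm (kernelOrders α a) α (kernelArgs α a b lam t))) ∧
    IsCompletelyMonotone (scalarKernel α a b lam) ∧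
    ∀ T : ℝ, 0 < T →
      IntervalIntegrable (scalarKernel α a b lam) MeasureTheory.volume 0 T ∧
      (∫ t in (0 : ℝ)..T, |scalarKernel α a b lam t|) < 1 / lam := by
  have hX : Measurable fun x : ℝ => -Real.exp x := by fun_prop
  have hneg (x : ℝ) : -Real.exp x < 0 := neg_neg_of_pos (Real.exp_pos x)
  have hst {s : ℝ} (hs : 0 < s) := stieltjes_spectralMeasure hα₀ hα₁ ha₀ ha₁ hb hlam hs
  have heq := scalarKernel_eq_mgf hα₀ hα₁ ha₀ ha₁ hb hlam
  refine ⟨fun t ht => ?_, (isCompletelyMonotone_mgf hX hneg (hst one_pos).1).congr heq,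
    fun T hT => ?_⟩
  · rw [kernelArgs_eq]
    exact summable_multinomialMLTerm_neg (kernelOrders_pos hα₀ ha₁) hα₀ (vecCons_pos hlam hb) ht
  have hpos (t : ℝ) (ht : 0 < t) : 0 < scalarKernel α a b lam t := by
    rw [heq ht]
    exact mgf_pos' (spectralMeasure_ne_zero hα₀ hα₁ ha₀ ha₁ hb hlam)
      (integrable_exp_mul_of_integrable_inv_sub hX hneg (hst one_pos).1 ht)
  have heq' (s : ℝ) : EqOn (fun t => Real.exp (-(s * t)) * scalarKernel α a b lam t)
      (fun t => Real.exp (-(s * t)) *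
        mgf (fun x => -Real.exp x) (spectralMeasure α a b lam) t) (Ioi 0) :=
    fun t ht => congrArg (Real.exp (-(s * t)) * ·) (heq ht)
  obtain ⟨h1, h2⟩ := integral_lt_of_laplace_le (M := 1 / lam) hpos
    (fun s hs => (integrableOn_exp_neg_mul_mgf hX hneg hs (hst hs).1).congr_fun (heq' s).symm
      measurableSet_Ioi)
    (fun s hs => by
      rw [setIntegral_congr_fun measurableSet_Ioi (heq' s),
        integral_exp_neg_mul_mgf hX hneg hs (hst hs).1, (hst hs).2, one_div]
      -- The transform is `1 / P(s)`, and `P(s) ≥ lam` since its other terms are nonnegative.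
      refine inv_anti₀ hlam ?_
      have h0 : 0 ≤ ∑ i, b i * s ^ a i :=
        Finset.sum_nonneg fun i _ => mul_nonneg (hb i).le (by positivity)
      have : 0 < s ^ α := by positivity
      linarith) hT
  refine ⟨h1, ?_⟩
  rwa [intervalIntegral.integral_of_le hT.le, setIntegral_congr_fun measurableSet_Ioc
    (fun t ht => abs_of_pos (hpos t ht.1)), ← intervalIntegral.integral_of_le hT.le]
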